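/- Let $FQ_n$ be the $n$-dimensional folded hypercube: its vertices are the binary strings of length $n$, and two distinct strings are adjacent if and only if they differ in exactly one position or in all $n$ positions. For a finite non-complete connected graph $G$ and $m\ge 1$, an $m$-component cut of $G$ is a set of vertices whose deletion leaves a graph with at least $m$ connected components, and the $m$-component connectivity $c\kappa_m(G)$ is the smallest size of an $m$-component cut of $G$. **Theorem.** Let $n\ge 8$ and $1\le g\le n+1$. Then $FQ_n$ has a $(g+1)$-component cut, and $$c\kappa_{g+1}(FQ_n)=g(n+1)-\tfrac12\,g(g+1)+1 .$$ -/

import Mathlib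

/-- The `n`-dimensional hypercube `Q_n`: the vertices are the `n`-bit strings, and two of them are
adjacent when they differ in exactly one position. -/
def hypercubeGraph (n : ℕ) : SimpleGraph (Fin n → Bool) where
  Adj u v := hammingDist u v = 1
  symm := ⟨fun u v h => by rw [hammingDist_comm]; exact h⟩
  loopless := ⟨fun u h => by simp at h⟩

/-- The `n`-dimensional folded hypercube `FQ_n`: the hypercube `Q_n` together with an edge between
any two vertices with complementary addresses. -/
def foldedHypercube (n : ℕ) : SimpleGraph (Fin n → Bool) :=
  hypercubeGraph n ⊔ SimpleGraph.fromRel (fun u v => ∀ i, v i = !(u i))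

/-- `F` is a `g`-component cut of `G`: deleting the vertices of `F` leaves a graph with at least
`g` connected components. -/
def IsComponentCut {V : Type*} [Fintype V] (G : SimpleGraph V) (g : ℕ) (F : Finset V) : Prop :=
  g ≤ Nat.card (G.induce {v : V | v ∉ F}).ConnectedComponent

/-- The `g`-component connectivity `cκ_g(G)`: the smallest size of a `g`-component cut of `G`. -/
noncomputable def componentConnectivity {V : Type*} [Fintype V] (G : SimpleGraph V) (g : ℕ) : ℕ :=
  sInf {k : ℕ | ∃ F : Finset V, IsComponentCut G g F ∧ F.card = k}

/-! Put h(m) = m(n+1) - m(m+1)/2 + 1. Deleting the neighbours of g neighbours of one vertex isolates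
those g vertices and costs at most h(g).

For the lower bound, suppose |F| < h(g). Since h never exceeds n(n+1)/2 + 1, |F| ≤ n(n+1)/2. Any
union of components and the union of the others are separated by F already in the plain cube, where
`SepCard.le_or_le` leaves at most n+2 vertices on one side. So at most one component is large, and g
of the small ones have m vertices together, with g ≤ m ≤ n+2. Here the antipodal edges matter:
closed neighbourhoods in the folded cube overlap so little that `card_biUnion_of_sparse` gives |F| ≥
h(m). As h is nondecreasing up to n+1, this contradicts |F| < h(g), with m = n+2 needing a separate
argument.

`SepCard.le_or_le` comes from an induction on the dimension that splits the cube into two facets and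
starts from a table computed for dimension 6. -/

/-! ### Separated sets in the hypercube -/

/-- `SepCard d a b`: the `d`-cube has sets of `a` and of `b` vertices, disjoint and without edges
between them. -/
def SepCard (d a b : ℕ) : Prop :=
  ∃ A B : Finset (Fin d → Bool),
    (∀ x ∈ A, ∀ y ∈ B, 1 < hammingDist x y) ∧ A.card = a ∧ B.card = b

theorem SepCard.symm {d a b : ℕ} (h : SepCard d a b) : SepCard d b a := by
  obtain ⟨A, B, h, ha, hb⟩ := h
  exact ⟨B, A, fun x hx y hy => by rw [hammingDist_comm]; exact h y hy x hx, hb, ha⟩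

theorem SepCard.add_le {d a b : ℕ} (h : SepCard d a b) : a + b ≤ 2 ^ d := by
  obtain ⟨A, B, h, rfl, rfl⟩ := h
  have hd : Disjoint A B := by
    rw [Finset.disjoint_left]
    intro x hx hy
    simpa using h x hx x hy
  rw [← Finset.card_union_of_disjoint hd]
  simpa using Finset.card_le_univ (A ∪ B)

theorem hammingDist_cons {d : ℕ} (b c : Bool) (x y : Fin d → Bool) :
    hammingDist (Fin.cons b x : Fin (d + 1) → Bool) (Fin.cons c y) =
      (if b = c then 0 else 1) + hammingDist x y := by
  unfold hammingDist
  rw [Fin.univ_succ, Finset.filter_cons]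
  by_cases hbc : b = c
  · simp [hbc, Finset.filter_map]
  · simp [hbc, Finset.filter_map, add_comm]

/-- The part of a set of vertices of the `(d + 1)`-cube in one of the two facets of the first
coordinate. -/
def facet {d : ℕ} (A : Finset (Fin (d + 1) → Bool)) (b : Bool) : Finset (Fin d → Bool) :=
  Finset.univ.filter fun x => (Fin.cons b x : Fin (d + 1) → Bool) ∈ A

theorem card_facet_add {d : ℕ} (A : Finset (Fin (d + 1) → Bool)) :
    (facet A false).card + (facet A true).card = A.card := by
  have key : ∀ b, (facet A b).card = (A.filter fun x => x 0 = b).card := by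
    intro b
    refine Finset.card_bij (fun x _ => Fin.cons b x) ?_ ?_ ?_
    · intro x hx
      simpa [facet] using hx
    · intro x _ y _ hxy
      exact (Fin.cons_injective2 hxy).2
    · intro x hx
      simp only [Finset.mem_filter] at hx
      refine ⟨Fin.tail x, ?_, ?_⟩
      · rw [facet, Finset.mem_filter, ← hx.2, Fin.cons_self_tail]
        exact ⟨Finset.mem_univ _, hx.1⟩
      · rw [← hx.2, Fin.cons_self_tail]
  rw [key, key, ← Finset.card_filter_add_card_filter_not (s := A) (fun x => x 0 = false)]
  simp

/-- All the inductions on dimension rest on this. The cross inequalities hold because the edges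
between the facets keep the projections of A and B from opposite facets disjoint. -/
theorem SepCard.split {d a b : ℕ} (h : SepCard (d + 1) a b) :
    ∃ a₀ a₁ b₀ b₁ : ℕ, a = a₀ + a₁ ∧ b = b₀ + b₁ ∧ SepCard d a₀ b₀ ∧ SepCard d a₁ b₁ ∧
      a₀ + b₁ ≤ 2 ^ d ∧ a₁ + b₀ ≤ 2 ^ d := by
  obtain ⟨A, B, h, rfl, rfl⟩ := h
  have sep : ∀ c : Bool, SepCard d (facet A c).card (facet B c).card := by
    intro c
    refine ⟨_, _, ?_, rfl, rfl⟩
    intro x hx y hy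
    simp only [facet, Finset.mem_filter, Finset.mem_univ, true_and] at hx hy
    simpa [hammingDist_cons] using h _ hx _ hy
  have cross : ∀ c c' : Bool, c ≠ c' → (facet A c).card + (facet B c').card ≤ 2 ^ d := by
    intro c c' hc
    have hd : Disjoint (facet A c) (facet B c') := by
      rw [Finset.disjoint_left]
      intro x hx hy
      simp only [facet, Finset.mem_filter, Finset.mem_univ, true_and] at hx hy
      simpa [hammingDist_cons, hc] using h _ hx _ hy
    rw [← Finset.card_union_of_disjoint hd]
    simpa using Finset.card_le_univ (facet A c ∪ facet B c')
  exact ⟨_, _, _, _, (card_facet_add A).symm, (card_facet_add B).symm, sep false, sep true,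
    cross _ _ (by decide), cross _ _ (by decide)⟩

/-- The vertex-isoperimetric inequality for small sets in the cube: `a ≥ 1` vertices have at least
`a * d - a * (a + 1) / 2 + 1` neighbours. -/
theorem SepCard.small {d a b : ℕ} (h : SepCard d a b) (ha : 1 ≤ a) :
    2 * (a + b) + 2 * a * d + 2 ≤ 2 * 2 ^ d + a * (a + 1) := by
  induction d generalizing a b with
  | zero =>
    have := h.add_le
    have hb : b = 0 := by simp at this; omega
    have ha : a = 1 := by simp at this; omega
    subst ha hb; norm_num
  | succ d ih =>
    obtain ⟨a₀, a₁, b₀, b₁, rfl, rfl, h₀, h₁, h₂, h₃⟩ := h.split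
    rw [pow_succ]
    rcases Nat.eq_zero_or_pos a₀ with rfl | ha₀
    · have := ih h₁ (by omega)
      nlinarith
    rcases Nat.eq_zero_or_pos a₁ with rfl | ha₁
    · have := ih h₀ (by omega)
      nlinarith
    have e₀ := ih h₀ ha₀
    have e₁ := ih h₁ ha₁
    -- This is (a₀ - 1)(a₁ - 1) ≥ 0, exactly what adding the two facet bounds lacks.
    have : a₀ + a₁ ≤ a₀ * a₁ + 1 := by nlinarith
    nlinarith

/-- `t` bounds the second entry of `SepCard d` in terms of the first one. -/
def SepTable (d : ℕ) (t : List ℕ) : Prop := ∀ a b, SepCard d a b → b ≤ t.getD a 0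

theorem SepTable.succ {d : ℕ} {t u : List ℕ} (ht : SepTable d t)
    (hu : ∀ a₀ < 2 ^ d + 1, ∀ a₁ < 2 ^ d + 1,
      min (t.getD a₀ 0) (2 ^ d - a₁) + min (t.getD a₁ 0) (2 ^ d - a₀) ≤ u.getD (a₀ + a₁) 0) :
    SepTable (d + 1) u := by
  intro a b h
  obtain ⟨a₀, a₁, b₀, b₁, rfl, rfl, h₀, h₁, h₂, h₃⟩ := h.split
  refine le_trans ?_ (hu a₀ (by omega) a₁ (by omega))
  exact add_le_add (le_min (ht _ _ h₀) (by omega)) (le_min (ht _ _ h₁) (by omega))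

/-- Dynamic programming over the facet splitting; the entries only need to be upper bounds. -/
theorem sepTable_six : SepTable 6 [64, 57, 52, 48, 45, 43, 42, 42, 38, 35, 33, 32, 32, 29, 27, 26, 26, 24, 23, 23, 22,
      22, 22, 19, 17, 16, 16, 14, 13, 13, 12, 12, 12, 10, 9, 9, 8, 8, 8, 7, 7, 7, 7, 5, 4,
      4, 3, 3, 3, 2, 2, 2, 2, 1, 1, 1, 1, 1, 0, 0, 0, 0, 0, 0, 0] := by
  have h0 : SepTable 0 [1, 0] := by
    intro a b h
    have := h.add_le
    have : a = 0 ∧ b = 0 ∨ a = 0 ∧ b = 1 ∨ a = 1 ∧ b = 0 := by simp at this; omega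
    rcases this with ⟨rfl, rfl⟩ | ⟨rfl, rfl⟩ | ⟨rfl, rfl⟩ <;> simp
  have h1 : SepTable 1 [2, 0, 0] := h0.succ (by decide +kernel)
  have h2 : SepTable 2 [4, 1, 0, 0, 0] := h1.succ (by decide +kernel)
  have h3 : SepTable 3 [8, 4, 2, 1, 1, 0, 0, 0, 0] := h2.succ (by decide +kernel)
  have h4 : SepTable 4 [16, 11, 8, 6, 5, 5, 3, 2, 2, 1, 1, 1, 0, 0, 0, 0, 0] := h3.succ (by
      decide +kernel)
  have h5 : SepTable 5 [32, 26, 22, 19, 17, 16, 16, 13, 11, 10, 10, 8, 7, 7, 6, 6, 6, 4, 3,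
      3, 2, 2, 2, 1, 1, 1, 1, 0, 0, 0, 0, 0, 0] := h4.succ (by decide +kernel)
  exact h5.succ (by decide +kernel)

theorem SepCard.six {a b : ℕ} (h : SepCard 6 a b) :
    (8 ≤ a → 8 ≤ b → a + b + 18 ≤ 64) ∧ (9 ≤ a → 9 ≤ b → a + b + 20 ≤ 64) := by
  have h1 := sepTable_six a b h
  have h2 := h.add_le
  have ha : a < 65 := by norm_num at h2; omega
  revert h1
  clear h h2
  revert a
  intro a ha h1
  interval_cases a <;> simp at h1 <;> omega

theorem chord_le {k a e : ℕ} (h₁ : k ≤ a) (h₂ : a ≤ e + 1) :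
    a * a + k * (e + 1) ≤ (k + e + 1) * a := by
  zify at *
  nlinarith [mul_nonneg (sub_nonneg.2 h₁) (sub_nonneg.2 h₂)]

theorem mul_rearrange {k a b e : ℕ} (h₁ : k ≤ e) (h₂ : b ≤ a) :
    e * b + k * a ≤ e * a + k * b := by
  zify at *
  nlinarith [mul_nonneg (sub_nonneg.2 h₁) (sub_nonneg.2 h₂)]

theorem quadratic_le_two_pow {e : ℕ} (he : 6 ≤ e) : e * e + 9 * e ≤ 2 * 2 ^ e := by
  induction e, he using Nat.le_induction with
  | base => norm_num
  | succ e he ih => rw [pow_succ]; nlinarith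

theorem SepCard.small_of_add_eq {e a b f : ℕ} (h : SepCard e a b) (hf : a + b + f = 2 ^ e)
    (ha : 1 ≤ a) : 2 * a * e + 2 ≤ 2 * f + a * (a + 1) := by
  have := h.small ha
  omega

/-- The bound of `SepCard.small` is concave in `a`, so on [2, e+1] it is least at an endpoint, here
at a = 2. -/
theorem SepCard.boundary_ge {e a b f : ℕ} (he : 6 ≤ e) (h : SepCard e a b)
    (hf : a + b + f = 2 ^ e) (ha : 2 ≤ a) (ha' : a ≤ e + 1) : 4 * e ≤ 2 * f + 4 := by
  have h₁ := h.small_of_add_eq hf (by omega)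
  have h₂ := chord_le ha ha'
  have h₃ := mul_rearrange (k := 4) (e := e) (by omega) ha
  nlinarith

/-- Here `f₀`, `f₁` count the separator in each facet. If both are small, `a₀` and `a₁` are both at
most e+1, and by concavity the worst case is sizes 2 and e+1; the constant 6 makes it an equality.
If `f₁` is large, `f₀` is so small that a₀ ≤ 1, and then a₁ ≤ a₀ + f₀ is too small as well. -/
theorem sepCard_step_one {e a₀ a₁ b₀ b₁ f₀ f₁ : ℕ} (he : 6 ≤ e)
    (ih : ∀ a b, SepCard e a b → e + 2 ≤ a → e + 2 ≤ b → 2 * (a + b) + e * (e + 1) ≤ 2 * 2 ^ e + 6)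
    (h₀ : SepCard e a₀ b₀) (h₁ : SepCard e a₁ b₁) (hf₀ : a₀ + b₀ + f₀ = 2 ^ e)
    (hf₁ : a₁ + b₁ + f₁ = 2 ^ e) (hc : a₁ + b₀ ≤ 2 ^ e) (hf : f₀ ≤ f₁)
    (hab : a₀ ≤ b₀) (ha : e + 3 ≤ a₀ + a₁) :
    (e + 1) * (e + 2) ≤ 2 * (f₀ + f₁) + 6 := by
  by_contra! hlt
  have hq := quadratic_le_two_pow he
  have hee : 6 * e ≤ e * e := Nat.mul_le_mul_right e he
  have ha₀ : a₀ ≤ e + 1 := by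
    by_contra! h
    have := ih a₀ b₀ h₀ (by omega) (by omega)
    nlinarith
  by_cases hF : 2 * f₁ + 6 < e * (e + 1)
  · have hb₁ : e + 2 ≤ b₁ := by
      by_contra! h
      nlinarith
    have ha₁ : a₁ ≤ e + 1 := by
      by_contra! h
      have := ih a₁ b₁ h₁ (by omega) (by omega)
      nlinarith
    have s₀ := h₀.small_of_add_eq hf₀ (by omega)
    have s₁ := h₁.small_of_add_eq hf₁ (by omega)
    have c₀ := chord_le (k := 2) (by omega) ha₀
    have c₁ := chord_le (k := 2) (by omega) ha₁
    have := mul_rearrange (k := 4) (e := e) (by omega) ha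
    nlinarith
  · have hf₀' : f₀ ≤ e := by
      by_contra! h
      nlinarith
    have : a₀ ≤ 1 := by
      by_contra! h
      have := h₀.boundary_ge he hf₀ h ha₀
      omega
    omega

/-- The same scheme, but a facet may now hold exactly e+2 vertices of the small side, beyond the
reach of `boundary_ge`; this is why the weaker bound `ih₁` is carried along. The constant 16 is
attained by sizes 3 and e+1, and by adding the bounds for 2 and e+2. -/
theorem sepCard_step_two {e a₀ a₁ b₀ b₁ f₀ f₁ : ℕ} (he : 6 ≤ e)
    (ih₁ : ∀ a b, SepCard e a b → e + 2 ≤ a → e + 2 ≤ b →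
      2 * (a + b) + e * (e + 1) ≤ 2 * 2 ^ e + 6)
    (ih₂ : ∀ a b, SepCard e a b → e + 3 ≤ a → e + 3 ≤ b →
      2 * (a + b) + (e + 1) * (e + 2) ≤ 2 * 2 ^ e + 16)
    (h₀ : SepCard e a₀ b₀) (h₁ : SepCard e a₁ b₁) (hf₀ : a₀ + b₀ + f₀ = 2 ^ e)
    (hf₁ : a₁ + b₁ + f₁ = 2 ^ e) (hc : a₁ + b₀ ≤ 2 ^ e) (hf : f₀ ≤ f₁)
    (hab : a₀ ≤ b₀) (ha : e + 4 ≤ a₀ + a₁) :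
    (e + 2) * (e + 3) ≤ 2 * (f₀ + f₁) + 16 := by
  by_contra! hlt
  have hq := quadratic_le_two_pow he
  have hee : 6 * e ≤ e * e := Nat.mul_le_mul_right e he
  have ha₀ : a₀ ≤ e + 2 := by
    by_contra! h
    have := ih₂ a₀ b₀ h₀ (by omega) (by omega)
    nlinarith
  by_cases hF : 2 * f₁ + 16 < (e + 1) * (e + 2)
  · have hb₁ : e + 3 ≤ b₁ := by
      by_contra! h
      nlinarith
    have ha₁ : a₁ ≤ e + 2 := by
      by_contra! h
      have := ih₂ a₁ b₁ h₁ (by omega) (by omega)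
      nlinarith
    have g₀ : 4 * e ≤ 2 * f₀ + 4 := by
      rcases Nat.lt_or_ge a₀ (e + 2) with h | h
      · exact h₀.boundary_ge he hf₀ (by omega) (by omega)
      · have := ih₁ a₀ b₀ h₀ h (by omega)
        nlinarith
    have g₁ : 4 * e ≤ 2 * f₁ + 4 := by
      rcases Nat.lt_or_ge a₁ (e + 2) with h | h
      · exact h₁.boundary_ge he hf₁ (by omega) (by omega)
      · have := ih₁ a₁ b₁ h₁ h (by omega)
        nlinarith
    rcases Nat.lt_or_ge a₀ (e + 2) with h | h
    · rcases Nat.lt_or_ge a₁ (e + 2) with h' | h'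
      · have s₀ := h₀.small_of_add_eq hf₀ (by omega)
        have s₁ := h₁.small_of_add_eq hf₁ (by omega)
        have c₀ := chord_le (k := 3) (a := a₀) (e := e) (by omega) (by omega)
        have c₁ := chord_le (k := 3) (a := a₁) (e := e) (by omega) (by omega)
        have := mul_rearrange (k := 5) (e := e) (by omega) ha
        nlinarith
      · have := ih₁ a₁ b₁ h₁ h' (by omega)
        nlinarith
    · have := ih₁ a₀ b₀ h₀ h (by omega)
      nlinarith
  · have hf₀' : f₀ ≤ e + 1 := by
      by_contra! h
      nlinarith
    have : a₀ ≤ 1 := by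
      by_contra! h
      rcases Nat.lt_or_ge a₀ (e + 2) with h' | h'
      · have := h₀.boundary_ge he hf₀ h (by omega)
        omega
      · have s₀ := h₀.small_of_add_eq hf₀ (by omega)
        obtain rfl : a₀ = e + 2 := by omega
        nlinarith
    omega

theorem sepCard_bounds {d : ℕ} (hd : 6 ≤ d) :
    (∀ a b, SepCard d a b → d + 2 ≤ a → d + 2 ≤ b →
      2 * (a + b) + d * (d + 1) ≤ 2 * 2 ^ d + 6) ∧
    (∀ a b, SepCard d a b → d + 3 ≤ a → d + 3 ≤ b →
      2 * (a + b) + (d + 1) * (d + 2) ≤ 2 * 2 ^ d + 16) := by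
  induction d, hd using Nat.le_induction with
  | base =>
    refine ⟨fun a b h ha hb => ?_, fun a b h ha hb => ?_⟩
    · have := h.six.1 ha hb; norm_num; omega
    · have := h.six.2 ha hb; norm_num; omega
  | succ e he ih =>
    obtain ⟨ih₁, ih₂⟩ := ih
    refine ⟨fun a b h ha hb => ?_, fun a b h ha hb => ?_⟩
    all_goals
      obtain ⟨a₀, a₁, b₀, b₁, rfl, rfl, h₀, h₁, hc, hc'⟩ := h.split
      obtain ⟨f₀, hf₀⟩ := Nat.exists_eq_add_of_le h₀.add_le
      obtain ⟨f₁, hf₁⟩ := Nat.exists_eq_add_of_le h₁.add_le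
      rw [pow_succ]
      rcases le_total f₀ f₁ with hf | hf
    · rcases le_total a₀ b₀ with hab | hab
      · have := sepCard_step_one he ih₁ h₀ h₁ hf₀.symm hf₁.symm hc' hf hab (by omega)
        nlinarith
      · have := sepCard_step_one he ih₁ h₀.symm h₁.symm (f₀ := f₀) (f₁ := f₁) (by omega)
          (by omega) (by omega) hf hab (by omega)
        nlinarith
    · rcases le_total a₁ b₁ with hab | hab
      · have := sepCard_step_one he ih₁ h₁ h₀ hf₁.symm hf₀.symm hc hf hab (by omega)
        nlinarith
      · have := sepCard_step_one he ih₁ h₁.symm h₀.symm (f₀ := f₁) (f₁ := f₀) (by omega)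
          (by omega) (by omega) hf hab (by omega)
        nlinarith
    · rcases le_total a₀ b₀ with hab | hab
      · have := sepCard_step_two he ih₁ ih₂ h₀ h₁ hf₀.symm hf₁.symm hc' hf hab (by omega)
        nlinarith
      · have := sepCard_step_two he ih₁ ih₂ h₀.symm h₁.symm (f₀ := f₀) (f₁ := f₁) (by omega)
          (by omega) (by omega) hf hab (by omega)
        nlinarith
    · rcases le_total a₁ b₁ with hab | hab
      · have := sepCard_step_two he ih₁ ih₂ h₁ h₀ hf₁.symm hf₀.symm hc hf hab (by omega)
        nlinarith
      · have := sepCard_step_two he ih₁ ih₂ h₁.symm h₀.symm (f₀ := f₁) (f₁ := f₀) (by omega)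
          (by omega) (by omega) hf hab (by omega)
        nlinarith

/-- In the `n`-cube, `n ≥ 8`, at most `n * (n + 1) / 2` vertices separate two sets only if one of
the two has at most `n + 2` vertices. -/
theorem SepCard.le_or_le {n a b : ℕ} (hn : 8 ≤ n) (h : SepCard n a b)
    (hF : 2 * 2 ^ n ≤ 2 * (a + b) + n * (n + 1)) : a ≤ n + 2 ∨ b ≤ n + 2 := by
  by_contra! hab
  -- (n+1)(n+2) - 16 exceeds n(n+1) exactly when n ≥ 8.
  have := (sepCard_bounds (by omega)).2 a b h hab.1 hab.2
  nlinarith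

/-! ### Unions of sparsely overlapping sets -/

open Finset in
/-- Finsets of size `K` that pairwise meet in at most two points, and such that two of them that
meet a third one in disjoint traces are disjoint: the union of `m ≥ 1` of them has at least
`m * K - m * (m + 1) / 2 + 1` points. -/
theorem card_biUnion_of_sparse {V P : Type*} [DecidableEq V] [DecidableEq P] (B : V → Finset P)
    (K : ℕ) (hK : ∀ x, (B x).card = K) (h2 : ∀ x y, x ≠ y → (B x ∩ B y).card ≤ 2)
    (h3 : ∀ w x y, w ≠ x → w ≠ y → (B w ∩ B x).Nonempty → (B w ∩ B y).Nonempty →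
      B w ∩ B x ∩ B y = ∅ → B x ∩ B y = ∅)
    (W : Finset V) (hW : W.Nonempty) :
    2 * W.card * K + 2 ≤ 2 * (W.biUnion B).card + W.card * (W.card + 1) := by
  induction hm : W.card generalizing W with
  | zero => exact absurd hm (Finset.card_pos.2 hW).ne'
  | succ m ih =>
    rcases Nat.eq_zero_or_pos m with rfl | hmpos
    · obtain ⟨w, rfl⟩ := Finset.card_eq_one.1 hm
      simp [hK]
    let far : V → Finset V := fun w => (W.erase w).filter fun x => B w ∩ B x = ∅
    -- Remove the `w` with most far partners. With `x` near `w`, any other near `y` adds at most one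
    -- point outside `B x`, or two if it is in `opp`. By `h3` such `y` are far from `x`, so there
    -- are at most |far w| of them, and the overlap is at most 2 + |near| + |far w| = m + 1.
    obtain ⟨w, hw, hmax⟩ := W.exists_max_image (fun w => (far w).card) hW
    have hcov : (B w ∩ (W.erase w).biUnion B).card ≤ m + 1 := by
      by_cases hlink : ∃ x ∈ W.erase w, (B w ∩ B x).Nonempty
      · obtain ⟨x, hx, hwx⟩ := hlink
        rw [mem_erase] at hx
        let near := ((W.erase w).filter fun y => (B w ∩ B y).Nonempty).erase x
        let opp := near.filter fun y => B w ∩ B x ∩ B y = ∅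
        have hopp : opp.card ≤ (far x).card := by
          refine card_le_card ?_
          intro y hy
          simp only [opp, near, far, mem_filter, mem_erase] at hy ⊢
          exact ⟨⟨hy.1.1, hy.1.2.1.2⟩, h3 w x y (Ne.symm hx.1) (Ne.symm hy.1.2.1.1) hwx
            hy.1.2.2 hy.2⟩
        have hnear : near.card + 1 + (far w).card = m := by
          have h1 : near.card + 1 = ((W.erase w).filter fun y => (B w ∩ B y).Nonempty).card :=
            card_erase_add_one (by simp [hx, hwx])
          rw [h1]
          have h4 := card_filter_add_card_filter_not (s := W.erase w)
            (fun y => (B w ∩ B y).Nonempty)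
          rw [card_erase_of_mem hw, hm] at h4
          simp only [not_nonempty_iff_eq_empty] at h4
          simpa using h4
        have hsub : B w ∩ (W.erase w).biUnion B ⊆
            (B w ∩ B x) ∪ near.biUnion fun y => (B w ∩ B y) \ B x := by
          intro p hp
          simp only [mem_inter, mem_biUnion] at hp
          obtain ⟨hp, y, hy, hpy⟩ := hp
          by_cases hpx : p ∈ B x
          · simp [hp, hpx]
          · rw [mem_union, mem_biUnion]
            right
            refine ⟨y, ?_, by simp [hp, hpy, hpx]⟩
            simp only [near, mem_erase, mem_filter]
            refine ⟨fun h => hpx (h ▸ hpy), by simpa using hy, ⟨p, by simp [hp, hpy]⟩⟩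
        have hterm : ∀ y ∈ near, ((B w ∩ B y) \ B x).card ≤
            1 + if B w ∩ B x ∩ B y = ∅ then 1 else 0 := by
          intro y hy
          simp only [near, mem_erase, mem_filter] at hy
          have hle := h2 w y (Ne.symm hy.2.1.1)
          split_ifs with hxy
          · exact (card_le_card sdiff_subset).trans hle
          · obtain ⟨p, hp⟩ := nonempty_iff_ne_empty.2 hxy
            simp only [mem_inter] at hp
            have : (B w ∩ B y) \ B x ⊂ B w ∩ B y :=
              ⟨sdiff_subset, fun h => by
                have := h (mem_inter.2 ⟨hp.1.1, hp.2⟩)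
                simp [hp.1.2] at this⟩
            have := card_lt_card this
            omega
        have hsum : ∑ y ∈ near, ((B w ∩ B y) \ B x).card ≤ near.card + opp.card := by
          refine (sum_le_sum hterm).trans ?_
          simp [sum_add_distrib, opp]
        have := h2 w x (Ne.symm hx.1)
        have := hmax x hx.2
        have := card_le_card hsub
        have := card_union_le (B w ∩ B x) (near.biUnion fun y => (B w ∩ B y) \ B x)
        have := card_biUnion_le (s := near) (t := fun y => (B w ∩ B y) \ B x)
        omega
      · have : B w ∩ (W.erase w).biUnion B = ∅ := by
          rw [eq_empty_iff_forall_notMem]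
          intro p hp
          simp only [mem_inter, mem_biUnion] at hp
          obtain ⟨hp, y, hy, hpy⟩ := hp
          exact hlink ⟨y, hy, p, by simp [hp, hpy]⟩
        simp [this]
    have hcard : (W.erase w).card = m := by rw [card_erase_of_mem hw, hm]; rfl
    have hih := ih (W.erase w) (card_pos.1 (by omega)) hcard
    have hins : W.biUnion B = B w ∪ (W.erase w).biUnion B := by
      rw [← biUnion_insert, insert_erase hw]
    have hun := card_union_add_card_inter (B w) ((W.erase w).biUnion B)
    rw [← hins, hK] at hun
    nlinarith

/-! ### Closed neighbourhoods in the folded cube -/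

/-- The steps that lead from a vertex of the folded cube into its closed neighbourhood: stay
(`none`), go to the antipode (`some none`), or flip one position. -/
def foldedStep {n : ℕ} (o : Option (Option (Fin n))) (k : Fin n) : Bool :=
  decide (o = some none) ^^ decide (o = some (some k))

/-- The vertex reached from `x` by a step. -/
def foldedMove {n : ℕ} (x : Fin n → Bool) (o : Option (Option (Fin n))) (k : Fin n) : Bool :=
  x k ^^ foldedStep o k

/-- The closed neighbourhood of a vertex of the folded cube. -/
def foldedBall {n : ℕ} (x : Fin n → Bool) : Finset (Fin n → Bool) :=
  Finset.univ.image (foldedMove x)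

theorem mem_foldedBall {n : ℕ} {x y : Fin n → Bool} :
    y ∈ foldedBall x ↔ ∃ o, foldedMove x o = y := by
  simp [foldedBall]

theorem foldedStep_none {n : ℕ} (k : Fin n) : foldedStep none k = false := by
  simp [foldedStep]

theorem foldedMove_none {n : ℕ} (x : Fin n → Bool) : foldedMove x none = x := by
  funext k; simp [foldedMove, foldedStep]

/-- Over 𝔽₂ the only relation among the unit vectors and the all-ones vector involves all n+1 of
them. So if six steps sum to zero, each step other than staying occurs an even number of times. -/
theorem foldedStep_parity {n : ℕ} (hn : 7 ≤ n) (o₁ o₂ o₃ o₄ o₅ o₆ : Option (Option (Fin n)))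
    (h : ∀ k, (foldedStep o₁ k ^^ foldedStep o₂ k ^^ foldedStep o₃ k ^^ foldedStep o₄ k ^^
      foldedStep o₅ k ^^ foldedStep o₆ k) = false) (o : Option (Fin n)) :
    (decide (o₁ = some o) ^^ decide (o₂ = some o) ^^ decide (o₃ = some o) ^^
      decide (o₄ = some o) ^^ decide (o₅ = some o) ^^ decide (o₆ = some o)) = false := by
  have split : ∀ a₁ a₂ a₃ a₄ a₅ a₆ b₁ b₂ b₃ b₄ b₅ b₆ : Bool,
      ((a₁ ^^ b₁) ^^ (a₂ ^^ b₂) ^^ (a₃ ^^ b₃) ^^ (a₄ ^^ b₄) ^^ (a₅ ^^ b₅) ^^ (a₆ ^^ b₆)) =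
        ((a₁ ^^ a₂ ^^ a₃ ^^ a₄ ^^ a₅ ^^ a₆) ^^ (b₁ ^^ b₂ ^^ b₃ ^^ b₄ ^^ b₅ ^^ b₆)) := by
    intros; simp only [Bool.xor_comm, Bool.xor_left_comm]
  simp only [foldedStep, split] at h
  have hfree : ∃ k : Fin n, some (some k) ∉
      ({o₁, o₂, o₃, o₄, o₅, o₆} : Finset (Option (Option (Fin n)))) := by
    by_contra! hall
    have h1 : (Finset.univ.image fun k : Fin n => some (some k)).card ≤
        ({o₁, o₂, o₃, o₄, o₅, o₆} : Finset (Option (Option (Fin n)))).card :=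
      Finset.card_le_card fun x hx => by
        obtain ⟨k, -, rfl⟩ := Finset.mem_image.1 hx
        exact hall k
    have h2 : ({o₁, o₂, o₃, o₄, o₅, o₆} : Finset (Option (Option (Fin n)))).card ≤ 6 :=
      Finset.card_le_six
    rw [Finset.card_image_of_injective _ (fun a b hab => by simpa using hab)] at h1
    simp at h1
    omega
  obtain ⟨k, hk⟩ := hfree
  simp only [Finset.mem_insert, Finset.mem_singleton, not_or] at hk
  -- At a coordinate flipped by none of the six steps, only the antipodal terms survive.
  have h0 := h k
  simp only [Ne.symm hk.1, Ne.symm hk.2.1, Ne.symm hk.2.2.1, Ne.symm hk.2.2.2.1,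
    Ne.symm hk.2.2.2.2.1, Ne.symm hk.2.2.2.2.2, decide_false, Bool.xor_false] at h0
  cases o with
  | none => exact h0
  | some k => simpa only [h0, Bool.false_xor] using h k

theorem foldedMove_eq_iff {n : ℕ} {x y : Fin n → Bool} {o p : Option (Option (Fin n))} :
    foldedMove x o = foldedMove y p ↔
      ∀ k, (foldedStep o k ^^ foldedStep p k) = (x k ^^ y k) := by
  simp only [funext_iff, foldedMove]
  refine forall_congr' fun k => ?_
  generalize x k = a, y k = b, foldedStep o k = c, foldedStep p k = d
  revert a b c d
  decide

theorem foldedMove_comm {n : ℕ} {x y : Fin n → Bool} {o p : Option (Option (Fin n))}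
    (h : foldedMove x o = foldedMove y p) : foldedMove x p = foldedMove y o := by
  rw [foldedMove_eq_iff] at h ⊢
  intro k
  rw [← h k, Bool.xor_comm]

theorem foldedMove_injective {n : ℕ} (hn : 7 ≤ n) (x : Fin n → Bool) :
    Function.Injective (foldedMove x) := by
  intro o p h
  have hp := foldedStep_parity hn o p none none none none (fun k => by
    have := foldedMove_eq_iff.1 h k
    rw [Bool.xor_self] at this
    simpa only [foldedStep_none, Bool.xor_false] using this)
  cases o with
  | none =>
    cases p with
    | none => rfl
    | some p => simpa using hp p
  | some o =>
    by_contra h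
    simpa [Ne.symm h] using hp o

theorem card_foldedBall {n : ℕ} (hn : 7 ≤ n) (x : Fin n → Bool) :
    (foldedBall x).card = n + 2 := by
  rw [foldedBall, Finset.card_image_of_injective _ (foldedMove_injective hn x)]
  simp

/-- Two expressions of x + y as a sum of two steps use the same pair of steps; this is why two balls
share at most two points. -/
theorem foldedMove_pair {n : ℕ} (hn : 7 ≤ n) {x y : Fin n → Bool}
    {o p o' p' : Option (Option (Fin n))} (h : foldedMove x o = foldedMove y p)
    (h' : foldedMove x o' = foldedMove y p') (h0 : o ≠ none) (h1 : o ≠ p) (h2 : o ≠ o') :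
    o = p' := by
  obtain ⟨o, rfl⟩ := Option.ne_none_iff_exists'.1 h0
  have hp := foldedStep_parity hn (some o) p o' p' none none (fun k => by
    have e := foldedMove_eq_iff.1 h k
    have e' := foldedMove_eq_iff.1 h' k
    rw [← e] at e'
    simp only [foldedStep_none, Bool.xor_false]
    revert e'
    generalize foldedStep (some o) k = a
    generalize foldedStep p k = b
    generalize foldedStep o' k = c
    generalize foldedStep p' k = d
    revert a b c d
    decide) o
  by_contra h3
  simp [h1.symm, h2.symm, Ne.symm h3] at hp

theorem card_foldedBall_inter {n : ℕ} (hn : 7 ≤ n) (x y : Fin n → Bool) (hxy : x ≠ y) :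
    (foldedBall x ∩ foldedBall y).card ≤ 2 := by
  by_contra! h
  obtain ⟨p, q, r, hp, hq, hr, hpq, hpr, hqr⟩ := Finset.two_lt_card_iff.1 h
  simp only [Finset.mem_inter, mem_foldedBall] at hp hq hr
  obtain ⟨⟨o₁, rfl⟩, p₁, h₁⟩ := hp
  obtain ⟨⟨o₂, rfl⟩, p₂, h₂⟩ := hq
  obtain ⟨⟨o₃, rfl⟩, p₃, h₃⟩ := hr
  have ne : ∀ o, foldedMove x o ≠ foldedMove y o := by
    intro o h
    refine hxy (funext fun k => ?_)
    simpa using (foldedMove_eq_iff.1 h k).symm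
  have n₁ : o₁ ≠ p₁ := fun h => ne o₁ (by rw [← h₁, h])
  have n₂ : o₂ ≠ p₂ := fun h => ne o₂ (by rw [← h₂, h])
  have m₁₂ : o₁ ≠ o₂ := fun h => hpq (by rw [h])
  have m₁₃ : o₁ ≠ o₃ := fun h => hpr (by rw [h])
  have m₂₃ : o₂ ≠ o₃ := fun h => hqr (by rw [h])
  by_cases h0 : o₁ = none
  · have h0' : o₂ ≠ none := fun h => m₁₂ (h0.trans h.symm)
    have e₁ := foldedMove_pair hn h₂.symm h₁.symm h0' n₂ m₁₂.symm
    have e₃ := foldedMove_pair hn h₂.symm h₃.symm h0' n₂ m₂₃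
    exact hpr (by rw [← h₁, ← h₃, ← e₁, ← e₃])
  · have e₂ := foldedMove_pair hn h₁.symm h₂.symm h0 n₁ m₁₂
    have e₃ := foldedMove_pair hn h₁.symm h₃.symm h0 n₁ m₁₃
    exact hqr (by rw [← h₂, ← h₃, ← e₂, ← e₃])

/-- Three pairwise meetings form a triangle of six steps with sum zero, so parity applies. -/
theorem foldedBall_inter_eq_empty {n : ℕ} (hn : 7 ≤ n) (w x y : Fin n → Bool) (hwx : w ≠ x)
    (hwy : w ≠ y) (hx : (foldedBall w ∩ foldedBall x).Nonempty)
    (hy : (foldedBall w ∩ foldedBall y).Nonempty)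
    (h : foldedBall w ∩ foldedBall x ∩ foldedBall y = ∅) : foldedBall x ∩ foldedBall y = ∅ := by
  by_contra hne
  obtain ⟨r, hr⟩ := Finset.nonempty_iff_ne_empty.2 hne
  obtain ⟨p, hp⟩ := hx
  obtain ⟨q, hq⟩ := hy
  simp only [Finset.mem_inter, mem_foldedBall] at hp hq hr
  obtain ⟨⟨o₁, rfl⟩, o₂, h₁⟩ := hp
  obtain ⟨⟨o₃, rfl⟩, o₄, h₂⟩ := hq
  obtain ⟨⟨o₅, rfl⟩, o₆, h₃⟩ := hr
  have ne : ∀ {u v : Fin n → Bool} {o}, foldedMove u o = foldedMove v o → u = v := by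
    intro u v o h
    refine funext fun k => ?_
    simpa using (foldedMove_eq_iff.1 h k).symm
  have no : ∀ o o' : Option (Option (Fin n)), foldedMove x o' = foldedMove w o →
      ∀ p', foldedMove y p' = foldedMove w o → False := by
    intro o o' ho p' hp'
    have : foldedMove w o ∈ foldedBall w ∩ foldedBall x ∩ foldedBall y := by
      simp only [Finset.mem_inter, mem_foldedBall]
      exact ⟨⟨⟨o, rfl⟩, o', ho⟩, p', hp'⟩
    rw [h] at this
    simp at this
  have h₁' := (foldedMove_comm h₁.symm).symm
  have h₂' := (foldedMove_comm h₂.symm).symm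
  have d₁₂ : o₁ ≠ o₂ := fun e => hwx (ne (o := o₁) (by rw [← h₁, e]))
  have d₃₄ : o₃ ≠ o₄ := fun e => hwy (ne (o := o₃) (by rw [← h₂, e]))
  have d₁₃ : o₁ ≠ o₃ := fun e => no o₁ o₂ h₁ o₄ (by rw [e, h₂])
  have d₁₄ : o₁ ≠ o₄ := fun e => no o₁ o₂ h₁ o₃ (by rw [e, h₂'])
  have d₂₃ : o₂ ≠ o₃ := fun e => no o₂ o₁ h₁' o₄ (by rw [e, h₂])
  have d₂₄ : o₂ ≠ o₄ := fun e => no o₂ o₁ h₁' o₃ (by rw [e, h₂'])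
  have hp := foldedStep_parity hn o₁ o₂ o₃ o₄ o₅ o₆ (fun k => by
    have e₁ := foldedMove_eq_iff.1 h₁ k
    have e₂ := foldedMove_eq_iff.1 h₂ k
    have e₃ := foldedMove_eq_iff.1 h₃ k
    revert e₁ e₂ e₃
    generalize foldedStep o₁ k = a₁
    generalize foldedStep o₂ k = a₂
    generalize foldedStep o₃ k = a₃
    generalize foldedStep o₄ k = a₄
    generalize foldedStep o₅ k = a₅
    generalize foldedStep o₆ k = a₆
    generalize w k = b₁
    generalize x k = b₂
    generalize y k = b₃
    revert a₁ a₂ a₃ a₄ a₅ a₆ b₁ b₂ b₃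
    decide +kernel)
  have q₁ : o₁ = none ∨ o₁ = o₅ ∨ o₁ = o₆ := by
    cases o₁ with
    | none => simp
    | some o =>
      by_contra! hc
      simpa [d₁₂.symm, d₁₃.symm, d₁₄.symm, hc.2.1.symm, hc.2.2.symm] using hp o
  have q₂ : o₂ = none ∨ o₂ = o₅ ∨ o₂ = o₆ := by
    cases o₂ with
    | none => simp
    | some o =>
      by_contra! hc
      simpa [d₁₂, d₂₃.symm, d₂₄.symm, hc.2.1.symm, hc.2.2.symm] using hp o
  have q₃ : o₃ = none ∨ o₃ = o₅ ∨ o₃ = o₆ := by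
    cases o₃ with
    | none => simp
    | some o =>
      by_contra! hc
      simpa [d₁₃, d₂₃, d₃₄.symm, hc.2.1.symm, hc.2.2.symm] using hp o
  have q₄ : o₄ = none ∨ o₄ = o₅ ∨ o₄ = o₆ := by
    cases o₄ with
    | none => simp
    | some o =>
      by_contra! hc
      simpa [d₁₄, d₂₄, d₃₄, hc.2.1.symm, hc.2.2.symm] using hp o
  -- Four distinct steps `o₁`, ..., `o₄` would lie in the three-element list `none`, `o₅`, `o₆`.
  grind

theorem hammingDist_eq_one_iff {n : ℕ} {x y : Fin n → Bool} :
    hammingDist x y = 1 ↔ ∃ i, foldedMove x (some (some i)) = y := by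
  rw [hammingDist, Finset.card_eq_one]
  refine exists_congr fun i => ?_
  simp only [Finset.ext_iff, Finset.mem_filter, Finset.mem_univ, true_and,
    Finset.mem_singleton, funext_iff, foldedMove, foldedStep]
  refine forall_congr' fun k => ?_
  by_cases hk : k = i
  · subst hk
    cases x k <;> cases y k <;> simp
  · have hk' : i ≠ k := Ne.symm hk
    cases x k <;> cases y k <;> simp [hk, hk']

theorem foldedMove_antipode {n : ℕ} {x y : Fin n → Bool} :
    foldedMove x (some none) = y ↔ ∀ i, y i = !(x i) := by
  simp [funext_iff, foldedMove, foldedStep, eq_comm]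

theorem foldedHypercube_adj {n : ℕ} (hn : 7 ≤ n) {x y : Fin n → Bool} :
    (foldedHypercube n).Adj x y ↔ ∃ o, foldedMove x (some o) = y := by
  have hanti : (∀ i, x i = !(y i)) ↔ ∀ i, y i = !(x i) :=
    forall_congr' fun i => by cases x i <;> cases y i <;> simp
  have hne : (∀ i, y i = !(x i)) → x ≠ y := by
    rintro h rfl
    simpa using h ⟨0, by omega⟩
  rw [foldedHypercube, SimpleGraph.sup_adj, SimpleGraph.fromRel_adj, hanti, or_self, Option.exists,
    foldedMove_antipode, ← hammingDist_eq_one_iff, or_comm]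
  exact or_congr ⟨fun h => h.2, fun h => ⟨hne h, h⟩⟩ Iff.rfl

theorem mem_foldedBall_iff {n : ℕ} (hn : 7 ≤ n) {x y : Fin n → Bool} :
    y ∈ foldedBall x ↔ y = x ∨ (foldedHypercube n).Adj x y := by
  rw [mem_foldedBall, Option.exists, foldedMove_none, foldedHypercube_adj hn, eq_comm]

/-! ### Components after the deletion -/

open scoped Classical in
/-- The vertices of a component that remains after the deletion of `F`. -/
noncomputable def componentVerts {V : Type*} [Fintype V] {G : SimpleGraph V} {F : Finset V}
    (c : (G.induce {v : V | v ∉ F}).ConnectedComponent) : Finset V :=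
  Finset.univ.filter fun v => ∃ h : v ∉ F,
    (G.induce {v : V | v ∉ F}).connectedComponentMk ⟨v, h⟩ = c

section

variable {V : Type*} [Fintype V] {G : SimpleGraph V} {F : Finset V}

theorem mem_componentVerts {c : (G.induce {v : V | v ∉ F}).ConnectedComponent} {v : V} :
    v ∈ componentVerts c ↔ ∃ h : v ∉ F,
      (G.induce {v : V | v ∉ F}).connectedComponentMk ⟨v, h⟩ = c := by
  simp [componentVerts]

theorem componentVerts_nonempty (c : (G.induce {v : V | v ∉ F}).ConnectedComponent) :
    (componentVerts c).Nonempty := by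
  obtain ⟨⟨v, hv⟩, rfl⟩ := c.exists_rep
  exact ⟨v, mem_componentVerts.2 ⟨hv, rfl⟩⟩

theorem eq_of_mem_componentVerts {c c' : (G.induce {v : V | v ∉ F}).ConnectedComponent} {v : V}
    (h : v ∈ componentVerts c) (h' : v ∈ componentVerts c') : c = c' := by
  obtain ⟨_, rfl⟩ := mem_componentVerts.1 h
  obtain ⟨_, rfl⟩ := mem_componentVerts.1 h'
  rfl

theorem mem_componentVerts_of_adj {c : (G.induce {v : V | v ∉ F}).ConnectedComponent} {v w : V}
    (h : v ∈ componentVerts c) (hvw : G.Adj v w) (hw : w ∉ F) : w ∈ componentVerts c := by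
  obtain ⟨hv, rfl⟩ := mem_componentVerts.1 h
  refine mem_componentVerts.2 ⟨hw, SimpleGraph.ConnectedComponent.eq.2 ?_⟩
  refine SimpleGraph.Adj.reachable ?_
  simpa using hvw.symm

open scoped Classical in
/-- The vertices of a set of components. -/
noncomputable def componentsVerts (T : Finset (G.induce {v : V | v ∉ F}).ConnectedComponent) :
    Finset V :=
  T.biUnion componentVerts

theorem card_componentsVerts (T : Finset (G.induce {v : V | v ∉ F}).ConnectedComponent) :
    (componentsVerts T).card = ∑ c ∈ T, (componentVerts c).card := by
  classical
  refine Finset.card_biUnion fun c _ c' _ hne => ?_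
  refine Finset.disjoint_left.2 ?_
  exact fun v hv hv' => hne (eq_of_mem_componentVerts hv hv')

theorem mem_componentsVerts {T : Finset (G.induce {v : V | v ∉ F}).ConnectedComponent} {v : V} :
    v ∈ componentsVerts T ↔ ∃ c ∈ T, v ∈ componentVerts c := by
  classical
  simp [componentsVerts]

theorem mem_componentsVerts_of_adj
    {T : Finset (G.induce {v : V | v ∉ F}).ConnectedComponent} {v w : V}
    (h : v ∈ componentsVerts T) (hvw : G.Adj v w) (hw : w ∉ F) : w ∈ componentsVerts T := by
  rw [mem_componentsVerts] at h ⊢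
  obtain ⟨c, hc, h⟩ := h
  exact ⟨c, hc, mem_componentVerts_of_adj h hvw hw⟩

end

section

variable {n : ℕ} {F : Finset (Fin n → Bool)}

open scoped Classical in
theorem componentsVerts_card_add_compl
    (T : Finset ((foldedHypercube n).induce {v | v ∉ F}).ConnectedComponent) :
    (componentsVerts T).card + (componentsVerts Tᶜ).card + F.card = 2 ^ n := by
  have h : (componentsVerts T).card + (componentsVerts Tᶜ).card = Fᶜ.card := by
    rw [card_componentsVerts, card_componentsVerts, Finset.sum_add_sum_compl,
      ← card_componentsVerts]
    congr 1
    ext v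
    simp [mem_componentsVerts, mem_componentVerts]
  rw [h, Finset.card_compl_add_card]
  simp

open scoped Classical in
theorem sepCard_componentsVerts
    (T : Finset ((foldedHypercube n).induce {v | v ∉ F}).ConnectedComponent) :
    SepCard n (componentsVerts T).card (componentsVerts Tᶜ).card := by
  refine ⟨_, _, fun x hx y hy => ?_, rfl, rfl⟩
  have hdisj : y ∉ componentsVerts T := by
    intro hy'
    rw [mem_componentsVerts] at hy hy'
    obtain ⟨c, hc, h⟩ := hy
    obtain ⟨c', hc', h'⟩ := hy'
    rw [eq_of_mem_componentVerts h h'] at hc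
    exact Finset.mem_compl.1 hc hc'
  have hyF : y ∉ F := by
    rw [mem_componentsVerts] at hy
    obtain ⟨c, -, h⟩ := hy
    exact (mem_componentVerts.1 h).1
  by_contra! hle
  rcases Nat.le_one_iff_eq_zero_or_eq_one.1 hle with h | h
  · rw [hammingDist_eq_zero] at h
    exact hdisj (h ▸ hx)
  · exact hdisj (mem_componentsVerts_of_adj hx (Or.inl h) hyF)

open scoped Classical in
theorem componentsVerts_card_le_or (hn : 8 ≤ n) (hF : 2 * F.card ≤ n * (n + 1))
    (T : Finset ((foldedHypercube n).induce {v | v ∉ F}).ConnectedComponent) :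
    (componentsVerts T).card ≤ n + 2 ∨ (componentsVerts Tᶜ).card ≤ n + 2 := by
  have := componentsVerts_card_add_compl T
  exact (sepCard_componentsVerts T).le_or_le hn (by omega)

/-- The vertex-isoperimetric inequality for unions of components. -/
theorem componentsVerts_boundary (hn : 7 ≤ n)
    {T : Finset ((foldedHypercube n).induce {v | v ∉ F}).ConnectedComponent}
    (hT : T.Nonempty) :
    2 * (componentsVerts T).card * (n + 1) + 2 ≤
      2 * F.card + (componentsVerts T).card * ((componentsVerts T).card + 1) := by
  classical
  have hne : (componentsVerts T).Nonempty := by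
    obtain ⟨c, hc⟩ := hT
    obtain ⟨v, hv⟩ := componentVerts_nonempty c
    exact ⟨v, mem_componentsVerts.2 ⟨c, hc, hv⟩⟩
  have h := card_biUnion_of_sparse foldedBall (n + 2) (card_foldedBall hn)
    (card_foldedBall_inter hn) (foldedBall_inter_eq_empty hn) (componentsVerts T) hne
  have hsub : (componentsVerts T).biUnion foldedBall ⊆ componentsVerts T ∪ F := by
    intro y hy
    obtain ⟨x, hx, hxy⟩ := Finset.mem_biUnion.1 hy
    rw [Finset.mem_union]
    by_cases hyF : y ∈ F
    · exact Or.inr hyF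
    · rcases (mem_foldedBall_iff hn).1 hxy with rfl | hadj
      · exact Or.inl hx
      · exact Or.inl (mem_componentsVerts_of_adj hx hadj hyF)
  have := (Finset.card_le_card hsub).trans (Finset.card_union_le _ _)
  nlinarith

-- Adding small components one at a time, the union cannot jump from at most n+2 vertices to nearly
-- everything, because 3(n+2) + n(n+1)/2 < 2^n.
open scoped Classical in
theorem componentsVerts_card_le_of_small (hn : 8 ≤ n) (hF : 2 * F.card ≤ n * (n + 1))
    (T : Finset ((foldedHypercube n).induce {v | v ∉ F}).ConnectedComponent)
    (hT : ∀ c ∈ T, (componentVerts c).card ≤ n + 2) : (componentsVerts T).card ≤ n + 2 := by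
  induction T using Finset.induction_on with
  | empty => simp [card_componentsVerts]
  | insert c T hc ih =>
    have h1 := ih fun c' hc' => hT c' (Finset.mem_insert_of_mem hc')
    have h2 := hT c (Finset.mem_insert_self c T)
    refine (componentsVerts_card_le_or hn hF (insert c T)).resolve_right fun h3 => ?_
    have h4 := componentsVerts_card_add_compl (insert c T)
    have h5 : (componentsVerts (insert c T)).card ≤ 2 * (n + 2) := by
      rw [card_componentsVerts] at h1 ⊢
      rw [Finset.sum_insert hc]
      omega
    have h6 := quadratic_le_two_pow (e := n) (by omega)
    nlinarith

open scoped Classical in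
/-- All components but at most one are small. -/
theorem exists_small_components (hn : 8 ≤ n) (hF : 2 * F.card ≤ n * (n + 1)) {g : ℕ}
    (hcut : IsComponentCut (foldedHypercube n) (g + 1) F) :
    ∃ T : Finset ((foldedHypercube n).induce {v | v ∉ F}).ConnectedComponent,
      T.card = g ∧ ∀ c ∈ T, (componentVerts c).card ≤ n + 2 := by
  let S : Finset ((foldedHypercube n).induce {v | v ∉ F}).ConnectedComponent :=
    Finset.univ.filter fun c => (componentVerts c).card ≤ n + 2
  have hlarge : Sᶜ.card ≤ 1 := by
    rw [Finset.card_le_one]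
    intro c hc c' hc'
    by_contra hne
    simp only [S, Finset.mem_compl, Finset.mem_filter, Finset.mem_univ, true_and] at hc hc'
    rcases componentsVerts_card_le_or hn hF {c} with h | h
    · rw [card_componentsVerts, Finset.sum_singleton] at h
      exact hc h
    · refine hc' (le_trans ?_ h)
      rw [card_componentsVerts]
      exact Finset.single_le_sum (f := fun c => (componentVerts c).card)
        (fun _ _ => Nat.zero_le _) (by simpa using Ne.symm hne)
  have hS : g ≤ S.card := by
    have := Finset.card_add_card_compl S
    rw [IsComponentCut, Nat.card_eq_fintype_card] at hcut
    omega
  obtain ⟨T, hTS, hT⟩ := Finset.exists_subset_card_eq hS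
  exact ⟨T, hT, fun c hc => (Finset.mem_filter.1 (hTS hc)).2⟩

theorem card_of_isComponentCut (hn : 8 ≤ n) {g : ℕ} (hg : 1 ≤ g) (hgn : g ≤ n + 1)
    (hcut : IsComponentCut (foldedHypercube n) (g + 1) F) :
    2 * g * (n + 1) + 2 ≤ 2 * F.card + g * (g + 1) := by
  classical
  by_contra! hlt
  obtain ⟨r, hr⟩ := Nat.exists_eq_add_of_le hgn
  -- |F| < h(g) ≤ n(n+1)/2 + 1; evenness of n(n+1) turns the strict inequality into this one.
  have hF : 2 * F.card ≤ n * (n + 1) := by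
    obtain ⟨k, hk⟩ := Nat.even_mul_succ_self n
    have : 2 * F.card < n * (n + 1) + 2 := by
      have hrr : r ≤ r * r := Nat.le_mul_self r
      zify at *
      have e : (n : ℤ) = g + r - 1 := by omega
      rw [e] at hlt ⊢
      nlinarith
    omega
  obtain ⟨T, hTg, hT⟩ := exists_small_components hn hF hcut
  have hm := componentsVerts_card_le_of_small hn hF T hT
  have hne : T.Nonempty := Finset.card_pos.1 (by omega)
  have hgm : g ≤ (componentsVerts T).card := by
    rw [card_componentsVerts, ← hTg, Finset.card_eq_sum_ones]
    exact Finset.sum_le_sum fun c _ => (componentVerts_nonempty c).card_pos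
  have hb := componentsVerts_boundary (by omega) hne
  rcases Nat.lt_or_ge n (componentsVerts T).card.pred with h | h
  · have hm' : (componentsVerts T).card = n + 2 := by
      rw [Nat.pred_eq_sub_one] at h; omega
    rw [hm'] at hb
    rcases Nat.lt_or_ge r 2 with hr2 | hr2
    -- For g ≥ n, n+2 vertices in g components force a singleton; dropping it leaves n+1 vertices,
    -- where h is maximal.
    · obtain ⟨c, hc, hc1⟩ : ∃ c ∈ T, (componentVerts c).card ≤ 1 := by
        by_contra! hall
        have : T.card * 2 ≤ (componentsVerts T).card := by
          rw [card_componentsVerts]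
          exact Finset.card_nsmul_le_sum T _ 2 fun c hc => hall c hc
        omega
      have hc1' : (componentVerts c).card = 1 :=
        le_antisymm hc1 (componentVerts_nonempty c).card_pos
      have hsum := Finset.add_sum_erase T (fun c => (componentVerts c).card) hc
      rw [← card_componentsVerts, ← card_componentsVerts] at hsum
      have herase : (componentsVerts (T.erase c)).card = n + 1 := by
        omega
      have hb' := componentsVerts_boundary (T := T.erase c) (by omega) (by
        rw [← Finset.card_pos, Finset.card_erase_of_mem hc]
        omega)
      rw [herase] at hb'
      nlinarith
    -- Now g ≤ n-1, and h(n+2) = h(n-1) ≥ h(g).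
    · zify at *
      have e : (n : ℤ) = g + r - 1 := by omega
      rw [e] at hlt hb
      nlinarith
  · have hm' : (componentsVerts T).card ≤ n + 1 := by
      rw [Nat.pred_eq_sub_one] at h; omega
    generalize (componentsVerts T).card = m at *
    obtain ⟨s, rfl⟩ := Nat.exists_eq_add_of_le hgm
    rcases Nat.eq_zero_or_pos s with rfl | hs
    · simp only [add_zero] at hb; omega
    · have : s * (2 * g + s + 1) ≤ s * (2 * (n + 1)) := Nat.mul_le_mul_left s (by omega)
      nlinarith

end

/-! ### A cut attaining the bound -/

/-- Deleting all neighbours of an independent set `S` isolates the vertices of `S`. -/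
theorem isComponentCut_of_isolated {V : Type*} [Fintype V] (G : SimpleGraph V) (S F : Finset V)
    (hSF : Disjoint S F) (hadj : ∀ x ∈ S, ∀ y, G.Adj x y → y ∈ F) (v : V) (hvS : v ∉ S)
    (hvF : v ∉ F) : IsComponentCut G (S.card + 1) F := by
  have hS : ∀ x ∈ S, x ∉ F := fun x hx => Finset.disjoint_left.1 hSF hx
  have hiso : ∀ (x y : {v : V | v ∉ F}), x.1 ∈ S →
      (G.induce {v : V | v ∉ F}).Reachable x y → x = y := by
    rintro x y hx ⟨p⟩
    cases p with
    | nil => rfl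
    | @cons _ w _ h p => exact absurd (hadj _ hx w (by simpa using h)) w.2
  let φ : Option S → (G.induce {v : V | v ∉ F}).ConnectedComponent := fun o =>
    match o with
    | none => (G.induce {v : V | v ∉ F}).connectedComponentMk ⟨v, hvF⟩
    | some x => (G.induce {v : V | v ∉ F}).connectedComponentMk ⟨x.1, hS _ x.2⟩
  have hφ : Function.Injective φ := by
    rintro (_ | ⟨x, hx⟩) (_ | ⟨y, hy⟩) h
    · rfl
    · have := hiso _ _ hy (SimpleGraph.ConnectedComponent.eq.1 h).symm
      simp only [Subtype.mk.injEq] at this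
      exact absurd (this ▸ hy) hvS
    · have := hiso _ _ hx (SimpleGraph.ConnectedComponent.eq.1 h)
      simp only [Subtype.mk.injEq] at this
      exact absurd (this ▸ hx) hvS
    · have := hiso _ _ hx (SimpleGraph.ConnectedComponent.eq.1 h)
      simp only [Subtype.mk.injEq] at this
      simp [this]
  have h := Nat.card_le_card_of_injective φ hφ
  simpa [IsComponentCut] using h

/-- The neighbours of the zero vertex of the folded cube. -/
def unitVertex {n : ℕ} (o : Option (Fin n)) : Fin n → Bool := foldedStep (some o)

theorem unitVertex_injective {n : ℕ} (hn : 7 ≤ n) :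
    Function.Injective (unitVertex : Option (Fin n) → Fin n → Bool) := by
  intro o p h
  have := foldedMove_injective hn (fun _ => false) (a₁ := some o) (a₂ := some p) (by
    funext k
    simpa [foldedMove, unitVertex] using congrFun h k)
  simpa using this

theorem foldedMove_unitVertex_comm {n : ℕ} (o p : Option (Fin n)) :
    foldedMove (unitVertex o) (some p) = foldedMove (unitVertex p) (some o) := by
  funext k
  simp [foldedMove, unitVertex, Bool.xor_comm]

theorem foldedMove_unitVertex_self {n : ℕ} (o : Option (Fin n)) :
    foldedMove (unitVertex o) (some o) = fun _ => false := by
  funext k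
  simp [foldedMove, unitVertex]

theorem foldedMove_unitVertex_ne {n : ℕ} (hn : 7 ≤ n) (o p q : Option (Fin n)) :
    foldedMove (unitVertex o) (some p) ≠ unitVertex q := by
  intro h
  have hpar := foldedStep_parity hn (some o) (some p) (some q) none none none (fun k => by
    have := congrFun h k
    simp only [foldedMove, unitVertex] at this
    simp only [foldedStep_none, Bool.xor_false]
    rw [this, Bool.xor_self])
  rcases eq_or_ne o p with rfl | hop
  · simpa using hpar q
  rcases eq_or_ne o q with rfl | hoq
  · simpa [hop] using hpar p
  · simpa [hop.symm, hoq.symm] using hpar o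

/-- A minimum cut: the neighbours of `g` neighbours of a vertex. -/
theorem exists_isComponentCut {n g : ℕ} (hn : 8 ≤ n) (hgn : g ≤ n + 1) :
    ∃ F : Finset (Fin n → Bool), IsComponentCut (foldedHypercube n) (g + 1) F ∧
      2 * F.card + g * (g + 1) ≤ 2 * g * (n + 1) + 2 := by
  classical
  obtain ⟨e⟩ : Nonempty (Option (Fin n) ≃ Fin (n + 1)) := ⟨Fintype.equivFinOfCardEq (by simp)⟩
  let u : Fin (n + 1) → Fin n → Bool := fun i => unitVertex (e.symm i)
  have hu : Function.Injective u := (unitVertex_injective (by omega)).comp e.symm.injective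
  let m : Fin (n + 1) → Fin (n + 1) → Fin n → Bool := fun i j =>
    foldedMove (u i) (some (e.symm j))
  let I : Finset (Fin (n + 1)) := Finset.univ.filter fun i => i.1 < g
  have hI : I.card = g := by
    simp only [I, Fin.card_filter_val_lt]
    omega
  let S := I.image u
  have hS : S.card = g := by rw [Finset.card_image_of_injective _ hu, hI]
  -- The neighbours of `u i` are the sums of `u i` with each `u j`. Zero is the sum for j = i, and
  -- keeping only i < j counts each other sum once.
  let F : Finset (Fin n → Bool) := insert (fun _ => false) (I.biUnion fun i =>
    (Finset.univ.filter fun j => i < j).image (m i))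
  have hF : ∀ i ∈ I, ∀ j, m i j ∈ F := by
    intro i hi j
    simp only [F, Finset.mem_insert, Finset.mem_biUnion, Finset.mem_image, Finset.mem_filter,
      Finset.mem_univ, true_and]
    rcases lt_trichotomy i j with h | rfl | h
    · exact Or.inr ⟨i, hi, j, h, rfl⟩
    · exact Or.inl (foldedMove_unitVertex_self _)
    · refine Or.inr ⟨j, ?_, i, h, foldedMove_unitVertex_comm _ _⟩
      simp only [I, Finset.mem_filter, Finset.mem_univ, true_and] at hi ⊢
      exact lt_trans h hi
  have hF' : ∀ x ∈ F, ∃ i j, x = m i j := by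
    intro x hx
    simp only [F, Finset.mem_insert, Finset.mem_biUnion, Finset.mem_image] at hx
    rcases hx with rfl | ⟨i, -, j, -, rfl⟩
    · exact ⟨0, 0, (foldedMove_unitVertex_self _).symm⟩
    · exact ⟨i, j, rfl⟩
  have hcard : 2 * F.card + g * (g + 1) ≤ 2 * g * (n + 1) + 2 := by
    have h1 : F.card ≤ (∑ i ∈ I, (n - i.1)) + 1 := by
      refine (Finset.card_insert_le _ _).trans (Nat.add_le_add_right ?_ 1)
      refine Finset.card_biUnion_le.trans (Finset.sum_le_sum fun i _ => ?_)
      refine Finset.card_image_le.trans ?_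
      have : (Finset.univ.filter fun j => i < j) = Finset.Ioi i := by ext; simp
      rw [this, Fin.card_Ioi]
      omega
    have h2 : ∀ k ≤ n + 1, 2 * (∑ i ∈ Finset.range k, (n - i)) + k * (k + 1) =
        2 * k * (n + 1) := by
      intro k hk
      induction k with
      | zero => simp
      | succ k ih =>
        have := ih (by omega)
        obtain ⟨r, rfl⟩ := Nat.exists_eq_add_of_le (Nat.le_of_succ_le_succ hk)
        rw [Finset.sum_range_succ, Nat.add_sub_cancel_left]
        nlinarith
    have h3 : ∑ i ∈ I, (n - i.1) = ∑ i ∈ Finset.range g, (n - i) := by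
      refine Finset.sum_bij (fun i _ => i.1) ?_ ?_ ?_ ?_
      · intro i hi
        simpa [I] using hi
      · intro i _ j _ h
        exact Fin.ext h
      · intro k hk
        rw [Finset.mem_range] at hk
        exact ⟨⟨k, by omega⟩, by simpa [I] using hk, rfl⟩
      · simp
    have := h2 g hgn
    omega
  have hdisj : Disjoint S F := by
    rw [Finset.disjoint_left]
    intro x hx hxF
    obtain ⟨k, -, rfl⟩ := Finset.mem_image.1 hx
    obtain ⟨i, j, h⟩ := hF' _ hxF
    exact foldedMove_unitVertex_ne (by omega) _ _ _ h.symm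
  obtain ⟨v, hv⟩ : ∃ v, v ∉ S ∪ F := by
    by_contra! hall
    have h1 : (S ∪ F).card = 2 ^ n := by
      rw [Finset.eq_univ_iff_forall.2 hall]
      simp
    have h2 := Finset.card_union_le S F
    have h3 := quadratic_le_two_pow (e := n) (by omega)
    obtain ⟨r, hr⟩ := Nat.exists_eq_add_of_le hgn
    have hrr : r ≤ r * r := Nat.le_mul_self r
    rw [h1, hS] at h2
    zify at *
    have e : (n : ℤ) = g + r - 1 := by omega
    nlinarith
  rw [Finset.mem_union, not_or] at hv
  refine ⟨F, ?_, hcard⟩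
  rw [← hS]
  refine isComponentCut_of_isolated _ S F hdisj ?_ v hv.1 hv.2
  intro x hx y hxy
  obtain ⟨i, hi, rfl⟩ := Finset.mem_image.1 hx
  obtain ⟨o, rfl⟩ := (foldedHypercube_adj (by omega)).1 hxy
  simpa [m] using hF i hi (e o)

theorem mainTheorem2 (n g : ℕ) (hn : 8 ≤ n) (hg : 1 ≤ g) (hgn : g ≤ n + 1) :
    (∃ F : Finset (Fin n → Bool), IsComponentCut (foldedHypercube n) (g + 1) F) ∧
      (componentConnectivity (foldedHypercube n) (g + 1) : ℚ) =
        (g : ℚ) * ((n : ℚ) + 1) - (g : ℚ) * ((g : ℚ) + 1) / 2 + 1 := by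
  obtain ⟨F, hF, hle⟩ := exists_isComponentCut hn hgn
  have hge := card_of_isComponentCut hn hg hgn hF
  have hconn : componentConnectivity (foldedHypercube n) (g + 1) = F.card := by
    refine le_antisymm (Nat.sInf_le ⟨F, hF, rfl⟩) (le_csInf ⟨_, F, hF, rfl⟩ ?_)
    rintro k ⟨F', hF', rfl⟩
    have := card_of_isComponentCut hn hg hgn hF'
    omega
  refine ⟨⟨F, hF⟩, ?_⟩
  have hcard : 2 * F.card + g * (g + 1) = 2 * g * (n + 1) + 2 := le_antisymm hle hge
  have hq : (2 * F.card + g * (g + 1) : ℚ) = 2 * g * (n + 1) + 2 := by exact_mod_cast hcard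
  rw [hconn]
  linarith
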